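/- Let $G$ be a finite simple graph with $n$ vertices and $m$ edges. Then there is a set $S$ of vertices of $G$ with \[ |S| \ge n - \frac{23m}{120} \] such that the induced subgraph $G[S]$ is planar and has treewidth at most $3$. (Here $23/120 \approx 1/5.2174$.) A graph has treewidth at most $k$ if it is a partial $k$-tree, that is, isomorphic to a subgraph of a $k$-tree; a $k$-tree is a graph that can be constructed from the complete graph $K_k$ by repeatedly picking a complete subgraph on $k$ vertices and joining a new vertex to all $k$ of them. A graph is planar if it can be drawn in the plane with distinct points as vertices and simple arcs as edges so that no vertex lies in the interior of an arc and the interiors of different arcs are disjoint. -/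

import Mathlib

namespace SimpleGraph

/-- The Euclidean plane. -/
abbrev Plane : Type := EuclideanSpace ℝ (Fin 2)

/-- A drawing of a simple graph in the plane without crossings: vertices are distinct points, every
edge is a simple arc joining the points of its two ends, no vertex lies in the interior of an arc,
and the interiors of different arcs are disjoint. -/
structure PlaneDrawing {V : Type*} (G : SimpleGraph V) where
  /-- the point that represents a vertex -/
  point : V → Plane
  /-- the arc that represents an edge -/
  arc : G.edgeSet → C(unitInterval, Plane)
  point_injective : Function.Injective point
  arc_injective : ∀ e, Function.Injective (arc e)
  arc_ends : ∀ e : G.edgeSet, s(arc e 0, arc e 1) = Sym2.map point (e : Sym2 V)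
  arc_ne_point : ∀ (e : G.edgeSet) (t : unitInterval), t ≠ 0 → t ≠ 1 →
    ∀ v : V, arc e t ≠ point v
  arc_disjoint : ∀ e f : G.edgeSet, e ≠ f → ∀ s t : unitInterval,
    s ≠ 0 → s ≠ 1 → t ≠ 0 → t ≠ 1 → arc e s ≠ arc f t

/-- A graph is planar if it can be drawn in the plane without crossings. -/
def IsPlanar {V : Type*} (G : SimpleGraph V) : Prop :=
  Nonempty G.PlaneDrawing

/-- The graph obtained from `G` by adding one new vertex `none`, adjacent to exactly the vertices
in `s`. -/
def attachVertex {V : Type*} (G : SimpleGraph V) (s : Set V) : SimpleGraph (Option V) where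
  Adj
    | some a, some b => G.Adj a b
    | some a, none => a ∈ s
    | none, some b => b ∈ s
    | none, none => False
  symm := ⟨by
    rintro (_ | a) (_ | b) h
    · exact h
    · exact h
    · exact h
    · exact h.symm⟩
  loopless := ⟨by
    rintro (_ | a) h
    · exact h
    · exact G.irrefl h⟩

/-- The `k`-trees: the complete graph on `k` vertices is a `k`-tree, and attaching a new vertex to
the `k` vertices of a complete subgraph of a `k`-tree gives a `k`-tree. Every `k`-tree in the usual
sense is isomorphic to one of these. -/
inductive IsKTree (k : ℕ) : {W : Type} → SimpleGraph W → Prop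
  | complete : IsKTree k (⊤ : SimpleGraph (Fin k))
  | attach {W : Type} (T : SimpleGraph W) (s : Finset W) :
      IsKTree k T → T.IsNClique k s → IsKTree k (T.attachVertex (s : Set W))

/-- A graph has treewidth at most `k` if it is a partial `k`-tree, that is, if it is (isomorphic to)
a subgraph, not necessarily induced or spanning, of a `k`-tree. -/
def TreewidthAtMost {V : Type*} (G : SimpleGraph V) (k : ℕ) : Prop :=
  ∃ (W : Type) (T : SimpleGraph W), IsKTree k T ∧ G.IsContained T

end SimpleGraph

/-! Vertices of degree at most two cost nothing. Delete such a vertex, join its two neighbours,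
treat the rest, and put the vertex back: in the drawing next to the edge between its neighbours, in
the 3-tree on a triangle through that edge. Four vertices without edges to the rest are free as
well, since K₄ is planar and a partial 3-tree. `IsTame` couples a straight-line drawing with an
embedding in a 3-tree, so that one and the same set serves both conclusions; `exists_reduction`
iterates the first operation without raising any degree.

The count uses a potential. In units of 1/240, a vertex of degree 3, 4 or d ≥ 5 weighs 60, 90 or
23d, never more than 23d, so the total is at most 46m; each deletion must release 240 units. A
vertex of degree at least 6 releases at least 6·23 + 6·23 = 276. If the maximum degree is 5, a
vertex of degree 5 releases at least 5·23 + 5·25 = 240. In a 4-regular graph a deletion releases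
only 90 + 4·30 = 210, and the missing 30 units force the stronger induction hypothesis `HasBound`:
30 units are left over whenever the maximum degree is at most 4 and some vertex has degree 3.

To keep this slack, delete a vertex of degree 4 with a neighbour of degree 3, or a vertex of degree
3 with all neighbours of degree 3; either releases at least 240. If a vertex of degree 3 remains
after reduction, the slack is inherited. If none remains, at least five vertices have vanished, and
they weighed at least 300. The exception is a set of exactly four vertices of degree 3 cut off from
the rest, which is kept whole. -/

namespace SimpleGraph

open Filter Topology

/-! ### Segments: overlaps and stability under perturbation -/

section Segment

variable {E : Type*} [AddCommGroup E] [Module ℝ E]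

/-- Two segments with a common end that share another point are nested. -/
theorem mem_segment_or_of_mem_of_mem {a b c x : E} (hb : x ∈ segment ℝ a b)
    (hc : x ∈ segment ℝ a c) (hx : x ≠ a) : b ∈ segment ℝ a c ∨ c ∈ segment ℝ a b := by
  have key : ∀ {b c : E} {s t : ℝ}, 0 < s → 0 ≤ t → t ≤ s → s • (b - a) = t • (c - a) →
      b ∈ segment ℝ a c := by
    intro b c s t hs ht hts h
    rw [segment_eq_image']
    refine ⟨t / s, ⟨by positivity, (div_le_one hs).2 hts⟩, ?_⟩
    have : b - a = (t / s) • (c - a) := by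
      rw [div_eq_inv_mul, mul_smul, ← h, smul_smul, inv_mul_cancel₀ hs.ne', one_smul]
    simp only
    rw [← this]
    abel
  rw [segment_eq_image'] at hb hc
  obtain ⟨s, ⟨hs, -⟩, rfl⟩ := hb
  obtain ⟨t, ⟨ht, -⟩, h⟩ := hc
  have h' : t • (c - a) = s • (b - a) := add_left_cancel h
  have hs' : 0 < s := hs.lt_of_ne (by rintro rfl; simp at hx)
  have ht' : 0 < t := ht.lt_of_ne (by rintro rfl; simp [← h'] at hx)
  rcases le_total t s with hts | hts
  · exact Or.inl (key hs' ht hts h'.symm)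
  · exact Or.inr (key ht' hs hts h')

end Segment

section Near

variable {E : Type*} [NormedAddCommGroup E] [NormedSpace ℝ E]

/-- Being disjoint from a closed set is stable under moving one end of a segment. -/
theorem isOpen_setOf_disjoint_segment (a : E) {K : Set E} (hK : IsClosed K) :
    IsOpen {q : E | Disjoint (segment ℝ a q) K} := by
  have hC : IsClosed {z : unitInterval × E | a + (z.1 : ℝ) • (z.2 - a) ∈ K} :=
    hK.preimage (by fun_prop)
  -- The bad ends `q` form the projection of a closed set along the compact parameter interval.
  have := (isClosedMap_snd_of_compactSpace (X := unitInterval) (Y := E)) _ hC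
  convert this.isOpen_compl using 1
  ext q
  simp only [Set.mem_ofPred_eq, Set.mem_compl_iff, Set.mem_image, Prod.exists, exists_eq_right, Set.disjoint_left, segment_eq_image']
  constructor
  · rintro h ⟨t, ht⟩
    exact h ⟨t, t.2, rfl⟩ ht
  · rintro h _ ⟨t, ht, rfl⟩ hx
    exact h ⟨⟨t, ht⟩, hx⟩

theorem isClosed_segment (a b : E) : IsClosed (segment ℝ a b) := by
  rw [segment_eq_image']
  exact (isCompact_Icc.image (by fun_prop)).isClosed

end Near

/-- Points of the plane off a segment accumulate at every point of the segment. -/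
theorem frequently_notMem_segment {a b : Plane} (hab : a ≠ b) :
    ∃ᶠ q in 𝓝 (midpoint ℝ a b), q ∉ segment ℝ a b := by
  -- `n` is `b - a` turned by a right angle; moving along it leaves the line through `a` and `b` at
  -- once.
  set n : Plane := !₂[-(b 1 - a 1), b 0 - a 0] with hn
  have ht : Tendsto (fun ε : ℝ => midpoint ℝ a b + ε • n) (𝓝[≠] 0) (𝓝 (midpoint ℝ a b)) := by
    have : Continuous fun ε : ℝ => midpoint ℝ a b + ε • n := by fun_prop
    have := this.tendsto 0
    simp only [zero_smul, add_zero] at this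
    exact this.mono_left nhdsWithin_le_nhds
  refine ht.frequently (Eventually.frequently ?_)
  filter_upwards [self_mem_nhdsWithin] with ε hε hmem
  rw [segment_eq_image'] at hmem
  obtain ⟨t, -, h⟩ := hmem
  have h0 := congrArg (fun v : Plane => v 0) h
  have h1 := congrArg (fun v : Plane => v 1) h
  simp [hn, midpoint_eq_smul_add] at h0 h1
  have hz : ε * ((b 0 - a 0) ^ 2 + (b 1 - a 1) ^ 2) = 0 := by
    linear_combination (b 1 - a 1) * h0 - (b 0 - a 0) * h1
  have hz' : (b 0 - a 0) ^ 2 + (b 1 - a 1) ^ 2 = 0 := by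
    rcases mul_eq_zero.1 hz with h | h
    · exact absurd h hε
    · exact h
  apply hab
  ext i
  fin_cases i
  · have : (b 0 - a 0) ^ 2 = 0 := by nlinarith [sq_nonneg (b 0 - a 0), sq_nonneg (b 1 - a 1)]
    simp at this ⊢
    linarith
  · have : (b 1 - a 1) ^ 2 = 0 := by nlinarith [sq_nonneg (b 0 - a 0), sq_nonneg (b 1 - a 1)]
    simp at this ⊢
    linarith

/-! ### Straight-line drawings -/

variable {V : Type*} {G H : SimpleGraph V} {S T : Finset V} {p : V → Plane}

/-- The map `p` draws the subgraph of `G` induced by `S` with straight edges and without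
crossings. -/
structure IsStraightDrawing (G : SimpleGraph V) (S : Finset V) (p : V → Plane) : Prop where
  injOn : Set.InjOn p S
  notMem : ∀ a ∈ S, ∀ b ∈ S, ∀ c ∈ S, G.Adj a b → c ≠ a → c ≠ b → p c ∉ segment ℝ (p a) (p b)
  disjoint : ∀ a ∈ S, ∀ b ∈ S, ∀ c ∈ S, ∀ d ∈ S, G.Adj a b → G.Adj c d →
    c ≠ a → c ≠ b → d ≠ a → d ≠ b → Disjoint (segment ℝ (p a) (p b)) (segment ℝ (p c) (p d))

namespace IsStraightDrawing

theorem mono (h : IsStraightDrawing H T p) (hST : S ⊆ T)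
    (hGH : ∀ a ∈ S, ∀ b ∈ S, G.Adj a b → H.Adj a b) : IsStraightDrawing G S p where
  injOn := h.injOn.mono (by exact_mod_cast hST)
  notMem a ha b hb c hc hab :=
    h.notMem a (hST ha) b (hST hb) c (hST hc) (hGH a ha b hb hab)
  disjoint a ha b hb c hc d hd hab hcd :=
    h.disjoint a (hST ha) b (hST hb) c (hST hc) d (hST hd) (hGH a ha b hb hab) (hGH c hc d hd hcd)

/-- Edges with a common end meet only there. -/
theorem eq_of_mem_of_mem (h : IsStraightDrawing G S p) {a b c : V} (ha : a ∈ S) (hb : b ∈ S)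
    (hc : c ∈ S) (hab : G.Adj a b) (hac : G.Adj a c) (hbc : b ≠ c) {x : Plane}
    (hxb : x ∈ segment ℝ (p a) (p b)) (hxc : x ∈ segment ℝ (p a) (p c)) : x = p a := by
  by_contra hx
  rcases mem_segment_or_of_mem_of_mem hxb hxc hx with h' | h'
  · exact h.notMem a ha c hc b hb hac hab.ne' hbc h'
  · exact h.notMem a ha b hb c hc hab hac.ne' hbc.symm h'

theorem right_notMem_segment_midpoint {a b : Plane} (hab : a ≠ b) :
    b ∉ segment ℝ a (midpoint ℝ a b) := by
  rw [segment_eq_image']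
  rintro ⟨t, ⟨-, ht⟩, h⟩
  have h1 : midpoint ℝ a b - a = (1 / 2 : ℝ) • (b - a) := by
    rw [midpoint_eq_smul_add, invOf_eq_inv]; module
  simp only [h1, smul_smul] at h
  have h2 : (t * (1 / 2) - 1) • (b - a) = 0 := by
    have : (t * (1 / 2) - 1) • (b - a) = (a + (t * (1 / 2)) • (b - a)) - b := by module
    rw [this, h, sub_self]
  rcases smul_eq_zero.1 h2 with h3 | h3
  · linarith
  · exact hab (sub_eq_zero.1 h3).symm

theorem segment_midpoint_subset (a b : Plane) :
    segment ℝ a (midpoint ℝ a b) ⊆ segment ℝ a b :=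
  (convex_segment a b).segment_subset (left_mem_segment ℝ a b) (midpoint_mem_segment a b)

/-- The half edge at `a` stops short of `p b`, so even the other edges at `b`, which meet the full
edge only in `p b`, stay clear of it. -/
theorem disjoint_segment_midpoint (h : IsStraightDrawing G S p) {a b c d : V} (ha : a ∈ S)
    (hb : b ∈ S) (hab : G.Adj a b) (hc : c ∈ S) (hd : d ∈ S) (hcd : G.Adj c d) (hca : c ≠ a)
    (hda : d ≠ a) :
    Disjoint (segment ℝ (p a) (midpoint ℝ (p a) (p b))) (segment ℝ (p c) (p d)) := by
  have hne : p a ≠ p b := fun he => hab.ne (h.injOn ha hb he)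
  have key : ∀ d ∈ S, G.Adj b d → d ≠ a →
      Disjoint (segment ℝ (p a) (midpoint ℝ (p a) (p b))) (segment ℝ (p b) (p d)) := by
    intro d hd hbd hda
    rw [Set.disjoint_left]
    intro x hx hx'
    have := h.eq_of_mem_of_mem hb ha hd hab.symm hbd hda.symm
      (by rw [segment_symm]; exact segment_midpoint_subset _ _ hx) hx'
    exact right_notMem_segment_midpoint hne (this ▸ hx)
  by_cases hcb : c = b
  · subst hcb
    exact key d hd hcd hda
  by_cases hdb : d = b
  · subst hdb
    rw [segment_symm ℝ (p c)]
    exact key c hc hcd.symm hca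
  exact (h.disjoint a ha b hb c hc d hd hab hcd hca hcb hda hdb).mono_left
    (segment_midpoint_subset _ _)

theorem notMem_segment_midpoint (h : IsStraightDrawing G S p) {a b c : V} (ha : a ∈ S)
    (hb : b ∈ S) (hab : G.Adj a b) (hc : c ∈ S) (hca : c ≠ a) :
    p c ∉ segment ℝ (p a) (midpoint ℝ (p a) (p b)) := by
  have hne : p a ≠ p b := fun he => hab.ne (h.injOn ha hb he)
  by_cases hcb : c = b
  · subst hcb
    exact right_notMem_segment_midpoint hne
  exact fun hx => h.notMem a ha b hb c hc hab hca hcb (segment_midpoint_subset _ _ hx)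

/-- At the midpoint itself these are finitely many conditions of disjointness from closed sets,
hence they persist nearby. -/
theorem eventually_segment (h : IsStraightDrawing G S p) {a b : V} (ha : a ∈ S) (hb : b ∈ S)
    (hab : G.Adj a b) :
    ∀ᶠ q in 𝓝 (midpoint ℝ (p a) (p b)), (∀ c ∈ S, c ≠ a → p c ∉ segment ℝ (p a) q) ∧
      ∀ c ∈ S, ∀ d ∈ S, G.Adj c d → c ≠ a → d ≠ a →
        Disjoint (segment ℝ (p a) q) (segment ℝ (p c) (p d)) := by
  refine Eventually.and ?_ ?_
  · rw [Finset.eventually_all]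
    intro c hc
    by_cases hca : c = a
    · exact Eventually.of_forall fun _ h => absurd hca h
    have h1 := (isOpen_setOf_disjoint_segment (p a) (isClosed_singleton (x := p c))).mem_nhds
      (x := midpoint ℝ (p a) (p b))
      (by simpa using h.notMem_segment_midpoint ha hb hab hc hca)
    filter_upwards [h1] with q hq _
    simpa using hq
  · rw [Finset.eventually_all]
    intro c hc
    rw [Finset.eventually_all]
    intro d hd
    by_cases hcd : G.Adj c d ∧ c ≠ a ∧ d ≠ a
    · obtain ⟨hcd, hca, hda⟩ := hcd
      have h1 := (isOpen_setOf_disjoint_segment (p a) (isClosed_segment (p c) (p d))).mem_nhds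
        (x := midpoint ℝ (p a) (p b))
        (h.disjoint_segment_midpoint ha hb hab hc hd hcd hca hda)
      filter_upwards [h1] with q hq _ _ _
      exact hq
    · exact Eventually.of_forall fun _ h1 h2 h3 => absurd ⟨h1, h2, h3⟩ hcd

/-- A new vertex all of whose neighbours are among the two ends of an edge can be drawn next to
that edge. -/
theorem exists_insert [DecidableEq V] (h : IsStraightDrawing G S p) {a b u : V} (ha : a ∈ S)
    (hb : b ∈ S) (hab : G.Adj a b) (hu : u ∉ S) (hN : ∀ v ∈ S, G.Adj u v → v = a ∨ v = b) :
    ∃ p', IsStraightDrawing G (insert u S) p' := by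
  have hne : p a ≠ p b := fun he => hab.ne (h.injOn ha hb he)
  have h1 := h.eventually_segment ha hb hab
  have h2 := h.eventually_segment hb ha hab.symm
  rw [midpoint_comm] at h2
  -- The new point lies near the midpoint but off the edge, which it must not subdivide; both
  -- segments to the ends are then harmless.
  obtain ⟨q, hq, ⟨hq1, hq2⟩, hq3, hq4⟩ :=
    ((frequently_notMem_segment hne).and_eventually (h1.and h2)).exists
  have hqe : ∀ x ∈ S, ∀ y ∈ S, G.Adj x y → q ∉ segment ℝ (p x) (p y) := by
    intro x hx y hy hxy hmem
    by_cases h1 : x ≠ a ∧ y ≠ a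
    · exact Set.disjoint_left.1 (hq2 x hx y hy hxy h1.1 h1.2) (right_mem_segment _ _ _) hmem
    by_cases h2 : x ≠ b ∧ y ≠ b
    · exact Set.disjoint_left.1 (hq4 x hx y hy hxy h2.1 h2.2) (right_mem_segment _ _ _) hmem
    -- An edge that avoids neither `a` nor `b` is the edge between them.
    have : (x = a ∧ y = b) ∨ (x = b ∧ y = a) := by
      have := hab.ne
      have := hxy.ne
      grind
    rcases this with ⟨rfl, rfl⟩ | ⟨rfl, rfl⟩
    · exact hq hmem
    · rw [segment_symm] at hmem
      exact hq hmem
  have hN1 : ∀ x ∈ S, G.Adj u x → ∀ c ∈ S, c ≠ x → p c ∉ segment ℝ (p x) q := by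
    intro x hx hux c hc hcx
    rcases hN x hx hux with rfl | rfl
    · exact hq1 c hc hcx
    · exact hq3 c hc hcx
  have hN2 : ∀ x ∈ S, G.Adj u x → ∀ c ∈ S, ∀ d ∈ S, G.Adj c d → c ≠ x → d ≠ x →
      Disjoint (segment ℝ (p x) q) (segment ℝ (p c) (p d)) := by
    intro x hx hux
    rcases hN x hx hux with rfl | rfl
    · exact hq2
    · exact hq4
  have hqp : ∀ c ∈ S, p c ≠ q := by
    intro c hc hcq
    by_cases hca : c = a
    · subst hca
      exact hq3 c hc hab.ne (hcq ▸ right_mem_segment _ _ _)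
    · exact hq1 c hc hca (hcq ▸ right_mem_segment _ _ _)
  have hup : ∀ c ∈ S, Function.update p u q c = p c := fun c hc =>
    Function.update_of_ne (fun he : c = u => hu (he ▸ hc)) _ _
  have huu : Function.update p u q u = q := Function.update_self _ _ _
  refine ⟨Function.update p u q, ?_, ?_, ?_⟩
  · intro x hx y hy hxy
    simp only [Finset.coe_insert, Set.mem_insert_iff, Finset.mem_coe] at hx hy
    rcases hx with rfl | hx <;> rcases hy with rfl | hy
    · rfl
    · rw [huu, hup y hy] at hxy
      exact absurd hxy.symm (hqp y hy)
    · rw [huu, hup x hx] at hxy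
      exact absurd hxy (hqp x hx)
    · rw [hup x hx, hup y hy] at hxy
      exact h.injOn hx hy hxy
  · intro x hx y hy c hc hxy hcx hcy
    rw [Finset.mem_insert] at hx hy hc
    rcases hx with rfl | hx <;> rcases hy with rfl | hy
    · exact absurd rfl hxy.ne
    · have hc := hc.resolve_left hcx
      rw [huu, hup y hy, hup c hc, segment_symm]
      exact hN1 y hy hxy c hc hcy
    · have hc := hc.resolve_left hcy
      rw [huu, hup x hx, hup c hc]
      exact hN1 x hx hxy.symm c hc hcx
    · rw [hup x hx, hup y hy]
      rcases hc with rfl | hc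
      · rw [huu]
        exact hqe x hx y hy hxy
      · rw [hup c hc]
        exact h.notMem x hx y hy c hc hxy hcx hcy
  · intro x hx y hy c hc d hd hxy hcd hcx hcy hdx hdy
    rw [Finset.mem_insert] at hx hy hc hd
    rcases hx with rfl | hx <;> rcases hy with rfl | hy
    · exact absurd rfl hxy.ne
    · have hc := hc.resolve_left hcx
      have hd := hd.resolve_left hdx
      rw [huu, hup y hy, hup c hc, hup d hd, segment_symm]
      exact hN2 y hy hxy c hc d hd hcd hcy hdy
    · have hc := hc.resolve_left hcy
      have hd := hd.resolve_left hdy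
      rw [huu, hup x hx, hup c hc, hup d hd]
      exact hN2 x hx hxy.symm c hc d hd hcd hcx hdx
    · rw [hup x hx, hup y hy]
      rcases hc with rfl | hc <;> rcases hd with rfl | hd
      · exact absurd rfl hcd.ne
      · rw [huu, hup d hd, segment_symm ℝ q]
        exact (hN2 d hd hcd x hx y hy hxy hdx.symm hdy.symm).symm
      · rw [huu, hup c hc]
        exact (hN2 c hc hcd.symm x hx y hy hxy hcx.symm hcy.symm).symm
      · rw [hup c hc, hup d hd]
        exact h.disjoint x hx y hy c hc d hd hxy hcd hcx hcy hdx hdy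

/-! ### Drawing four separate vertices beside the rest -/

/-- Four points of the plane, one of them inside the triangle that the others span. -/
def tetrad (r : ℝ) : Fin 4 → Plane :=
  ![!₂[r, 0], !₂[r + 3, 0], !₂[r, 3], !₂[r + 1, 1]]

theorem tetrad_injective (r : ℝ) : Function.Injective (tetrad r) := by
  intro i j h
  have h0 := congrArg (fun v : Plane => v 0) h
  have h1 := congrArg (fun v : Plane => v 1) h
  fin_cases i <;> fin_cases j <;> simp [tetrad] at h0 h1 ⊢

theorem le_tetrad (r : ℝ) (i : Fin 4) : r ≤ tetrad r i 0 := by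
  fin_cases i <;> simp [tetrad]

theorem tetrad_notMem (r : ℝ) {i j k : Fin 4} (hij : i ≠ j) (hki : k ≠ i) (hkj : k ≠ j) :
    tetrad r k ∉ segment ℝ (tetrad r i) (tetrad r j) := by
  rw [segment_eq_image']
  rintro ⟨t, ⟨ht0, ht1⟩, h⟩
  have h0 := congrArg (fun v : Plane => v 0) h
  have h1 := congrArg (fun v : Plane => v 1) h
  fin_cases i <;> fin_cases j <;> fin_cases k <;>
    first
    | exact absurd rfl hij
    | exact absurd rfl hki
    | exact absurd rfl hkj
    | (simp [tetrad] at h0 h1; done)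
    | (simp [tetrad] at h0 h1; linarith)

theorem tetrad_disjoint (r : ℝ) {i j k l : Fin 4} (hij : i ≠ j) (hkl : k ≠ l) (hki : k ≠ i)
    (hkj : k ≠ j) (hli : l ≠ i) (hlj : l ≠ j) :
    Disjoint (segment ℝ (tetrad r i) (tetrad r j)) (segment ℝ (tetrad r k) (tetrad r l)) := by
  rw [Set.disjoint_left, segment_eq_image', segment_eq_image']
  rintro _ ⟨s, ⟨hs0, hs1⟩, rfl⟩ ⟨t, ⟨ht0, ht1⟩, h⟩
  have h0 := congrArg (fun v : Plane => v 0) h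
  have h1 := congrArg (fun v : Plane => v 1) h
  clear h
  fin_cases i <;> fin_cases j <;> first | exact absurd rfl hij | skip
  all_goals
    fin_cases k <;> fin_cases l <;>
    first
    | exact absurd rfl hkl
    | exact absurd rfl hki
    | exact absurd rfl hkj
    | exact absurd rfl hli
    | exact absurd rfl hlj
    | (simp [tetrad] at h0 h1; done)
    | (simp [tetrad] at h0 h1; linarith)

theorem segment_fst_lt {r : ℝ} {a b x : Plane} (ha : a 0 < r) (hb : b 0 < r)
    (hx : x ∈ segment ℝ a b) : x 0 < r := by
  obtain ⟨s, t, hs, ht, hst, rfl⟩ := hx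
  simp only [PiLp.add_apply, PiLp.smul_apply, smul_eq_mul]
  calc s * a 0 + t * b 0 ≤ s * max (a 0) (b 0) + t * max (a 0) (b 0) := by gcongr <;> simp
    _ = max (a 0) (b 0) := by rw [← add_mul, hst, one_mul]
    _ < r := max_lt ha hb

theorem le_segment_fst {r : ℝ} {a b x : Plane} (ha : r ≤ a 0) (hb : r ≤ b 0)
    (hx : x ∈ segment ℝ a b) : r ≤ x 0 := by
  obtain ⟨s, t, hs, ht, hst, rfl⟩ := hx
  simp only [PiLp.add_apply, PiLp.smul_apply, smul_eq_mul]
  calc r = s * r + t * r := by rw [← add_mul, hst, one_mul]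
    _ ≤ s * a 0 + t * b 0 := by gcongr

/-- At most four vertices without edges to the others can be drawn apart from them. -/
theorem exists_union [DecidableEq V] (h : IsStraightDrawing G S p) (hT : T.card ≤ 4)
    (hST : Disjoint S T) (hN : ∀ a ∈ S, ∀ b ∈ T, ¬ G.Adj a b) :
    ∃ p', IsStraightDrawing G (S ∪ T) p' := by
  obtain ⟨f, hf⟩ : ∃ f : V → Fin 4, Set.InjOn f T := by
    have : Fintype.card T ≤ Fintype.card (Fin 4) := by simpa using hT
    obtain ⟨g⟩ := Function.Embedding.nonempty_of_card_le this
    refine ⟨fun v => if hv : v ∈ T then g ⟨v, hv⟩ else 0, fun x hx y hy hxy => ?_⟩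
    rw [Finset.mem_coe] at hx hy
    simpa [hx, hy] using hxy
  -- A vertical line to the right of the old drawing; the copy of K₄ goes beyond it, and half-planes
  -- are convex.
  obtain ⟨r, hr⟩ : ∃ r : ℝ, ∀ v ∈ S, p v 0 < r := by
    obtain ⟨r, hr⟩ := (S.image fun v => p v 0).bddAbove
    exact ⟨r + 1, fun v hv => lt_add_of_le_of_pos
      (hr (Finset.mem_coe.2 (Finset.mem_image_of_mem _ hv))) one_pos⟩
  have hT' : ∀ v ∈ T, v ∉ S := fun v hv hv' => Finset.disjoint_left.1 hST hv' hv
  set q : V → Plane := fun v => if v ∈ S then p v else tetrad r (f v) with hq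
  have hqS : ∀ v ∈ S, q v = p v := fun v hv => if_pos hv
  have hqT : ∀ v ∈ T, q v = tetrad r (f v) := fun v hv => if_neg (hT' v hv)
  have hS0 : ∀ v ∈ S, q v 0 < r := fun v hv => by rw [hqS v hv]; exact hr v hv
  have hT0 : ∀ v ∈ T, r ≤ q v 0 := fun v hv => by rw [hqT v hv]; exact le_tetrad r _
  have hedge : ∀ a ∈ S ∪ T, ∀ b ∈ S ∪ T, G.Adj a b → (a ∈ S ∧ b ∈ S) ∨ (a ∈ T ∧ b ∈ T) := by
    intro a ha b hb hab
    rw [Finset.mem_union] at ha hb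
    rcases ha with ha | ha <;> rcases hb with hb | hb
    · exact Or.inl ⟨ha, hb⟩
    · exact absurd hab (hN a ha b hb)
    · exact absurd hab.symm (hN b hb a ha)
    · exact Or.inr ⟨ha, hb⟩
  refine ⟨q, ?_, ?_, ?_⟩
  · intro x hx y hy hxy
    rw [Finset.mem_coe, Finset.mem_union] at hx hy
    have h0 : q x 0 = q y 0 := by rw [hxy]
    rcases hx with hx | hx <;> rcases hy with hy | hy
    · rw [hqS x hx, hqS y hy] at hxy
      exact h.injOn hx hy hxy
    · linarith [hS0 x hx, hT0 y hy]
    · linarith [hS0 y hy, hT0 x hx]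
    · rw [hqT x hx, hqT y hy] at hxy
      exact hf hx hy (tetrad_injective r hxy)
  · intro a ha b hb c hc hab hca hcb hmem
    rw [Finset.mem_union] at hc
    rcases hedge a ha b hb hab with ⟨ha, hb⟩ | ⟨ha, hb⟩ <;> rcases hc with hc | hc
    · rw [hqS a ha, hqS b hb, hqS c hc] at hmem
      exact h.notMem a ha b hb c hc hab hca hcb hmem
    · linarith [segment_fst_lt (hS0 a ha) (hS0 b hb) hmem, hT0 c hc]
    · linarith [le_segment_fst (hT0 a ha) (hT0 b hb) hmem, hS0 c hc]
    · rw [hqT a ha, hqT b hb, hqT c hc] at hmem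
      exact tetrad_notMem r (fun he => hab.ne (hf ha hb he)) (fun he => hca (hf hc ha he))
        (fun he => hcb (hf hc hb he)) hmem
  · intro a ha b hb c hc d hd hab hcd hca hcb hda hdb
    rcases hedge a ha b hb hab with ⟨ha, hb⟩ | ⟨ha, hb⟩ <;>
      rcases hedge c hc d hd hcd with ⟨hc, hd⟩ | ⟨hc, hd⟩
    · rw [hqS a ha, hqS b hb, hqS c hc, hqS d hd]
      exact h.disjoint a ha b hb c hc d hd hab hcd hca hcb hda hdb
    · rw [Set.disjoint_left]
      intro x hx hx'
      linarith [segment_fst_lt (hS0 a ha) (hS0 b hb) hx, le_segment_fst (hT0 c hc) (hT0 d hd) hx']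
    · rw [Set.disjoint_left]
      intro x hx hx'
      linarith [segment_fst_lt (hS0 c hc) (hS0 d hd) hx', le_segment_fst (hT0 a ha) (hT0 b hb) hx]
    · rw [hqT a ha, hqT b hb, hqT c hc, hqT d hd]
      exact tetrad_disjoint r (fun he => hab.ne (hf ha hb he)) (fun he => hcd.ne (hf hc hd he))
        (fun he => hca (hf hc ha he)) (fun he => hcb (hf hc hb he))
        (fun he => hda (hf hd ha he)) (fun he => hdb (hf hd hb he))

theorem isPlanar (h : IsStraightDrawing G S p) : (G.induce (S : Set V)).IsPlanar := by
  set K := G.induce (S : Set V) with hK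
  let q : ↥(S : Set V) → Plane := fun v => p v
  have hq : Function.Injective q := fun x y hxy => Subtype.ext (h.injOn x.2 y.2 hxy)
  -- An arc needs an orientation of its edge; `out` chooses one. The cases at the end account for
  -- all ways in which two chosen orientations can share an end.
  have hout : ∀ e : K.edgeSet, s(e.1.out.1, e.1.out.2) = e.1 := fun e => Quot.out_eq e.1
  have hadj : ∀ e : K.edgeSet, K.Adj e.1.out.1 e.1.out.2 := fun e => by
    have := e.2
    rw [← hout e] at this
    exact this
  have hne : ∀ e : K.edgeSet, q e.1.out.1 ≠ q e.1.out.2 := fun e he => (hadj e).ne (hq he)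
  let arc : K.edgeSet → C(unitInterval, Plane) := fun e =>
    ⟨fun t => AffineMap.lineMap (q e.1.out.1) (q e.1.out.2) (t : ℝ), by
      simp only [AffineMap.lineMap_apply_module]; fun_prop⟩
  have harc : ∀ e t, arc e t = AffineMap.lineMap (q e.1.out.1) (q e.1.out.2) (t : ℝ) :=
    fun _ _ => rfl
  have hinj : ∀ e, Function.Injective (arc e) := fun e s t hst =>
    Subtype.ext (AffineMap.lineMap_injective ℝ (hne e) hst)
  have h0 : ∀ e, arc e 0 = q e.1.out.1 := fun e => by simp [harc]
  have h1 : ∀ e, arc e 1 = q e.1.out.2 := fun e => by simp [harc]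
  have hseg : ∀ e t, arc e t ∈ segment ℝ (q e.1.out.1) (q e.1.out.2) := fun e t => by
    rw [segment_eq_image_lineMap]
    exact ⟨t, t.2, rfl⟩
  have hend : ∀ (e : K.edgeSet) (t : unitInterval), t ≠ 0 → t ≠ 1 → ∀ v, arc e t ≠ q v := by
    intro e t ht0 ht1 v hv
    by_cases hv1 : v = e.1.out.1
    · rw [hv1, ← h0] at hv
      exact ht0 (hinj e hv)
    by_cases hv2 : v = e.1.out.2
    · rw [hv2, ← h1] at hv
      exact ht1 (hinj e hv)
    refine h.notMem _ e.1.out.1.2 _ e.1.out.2.2 v v.2 (hadj e)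
      (fun he => hv1 (Subtype.ext he)) (fun he => hv2 (Subtype.ext he)) ?_
    have := hseg e t
    rw [hv] at this
    exact this
  refine ⟨⟨q, arc, hq, hinj, ?_, hend, ?_⟩⟩
  · intro e
    rw [h0, h1]
    conv_rhs => rw [← hout e]
    rfl
  · intro e f hef s t hs0 hs1 ht0 ht1 hst
    have key : ∀ a b c : ↥(S : Set V), K.Adj a b → K.Adj a c → b ≠ c →
        arc e s ∈ segment ℝ (q a) (q b) → arc e s ∈ segment ℝ (q a) (q c) → False := by
      intro a b c hab hac hbc hb hc
      exact hend e s hs0 hs1 a (h.eq_of_mem_of_mem a.2 b.2 c.2 hab hac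
        (fun he => hbc (Subtype.ext he)) hb hc)
    have hes := hseg e s
    have hft := hseg f t
    rw [← hst] at hft
    have hes' := segment_symm ℝ (q e.1.out.1) _ ▸ hes
    have hft' := segment_symm ℝ (q f.1.out.1) _ ▸ hft
    have hef' : s(e.1.out.1, e.1.out.2) ≠ s(f.1.out.1, f.1.out.2) := by
      rw [hout, hout]
      exact fun he => hef (Subtype.ext he)
    have ha := hadj e
    have hb := hadj f
    revert hes hft hes' hft' hef' ha hb
    generalize e.1.out.1 = a
    generalize e.1.out.2 = b
    generalize f.1.out.1 = c
    generalize f.1.out.2 = d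
    intro hes hft hes' hft' hef' hab hcd
    by_cases hca : c = a
    · subst hca
      exact key c b d hab hcd (by rintro rfl; exact hef' rfl) hes hft
    by_cases hcb : c = b
    · subst hcb
      exact key c a d hab.symm hcd (by rintro rfl; exact hef' Sym2.eq_swap) hes' hft
    by_cases hda : d = a
    · subst hda
      exact key d b c hab hcd.symm (by rintro rfl; exact hef' Sym2.eq_swap) hes hft'
    by_cases hdb : d = b
    · subst hdb
      exact key d a c hab.symm hcd.symm (by rintro rfl; exact hef' rfl) hes' hft'
    exact Set.disjoint_left.1 (h.disjoint a a.2 b b.2 c c.2 d d.2 hab hcd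
      (fun he => hca (Subtype.ext he)) (fun he => hcb (Subtype.ext he))
      (fun he => hda (Subtype.ext he)) (fun he => hdb (Subtype.ext he))) hes hft

end IsStraightDrawing

end SimpleGraph

/-! ### Partial 3-trees -/

namespace SimpleGraph

/-- The map `φ` embeds the subgraph of `G` induced by `S` into `T`. -/
structure IsPartialHom {V W : Type*} (G : SimpleGraph V) (S : Finset V) (T : SimpleGraph W)
    (φ : V → W) : Prop where
  injOn : Set.InjOn φ S
  adj : ∀ a ∈ S, ∀ b ∈ S, G.Adj a b → T.Adj (φ a) (φ b)

/-- The subgraph of `G` induced by `S` is a partial `k`-tree. -/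
def IsPartialKTree {V : Type*} (G : SimpleGraph V) (S : Finset V) (k : ℕ) : Prop :=
  ∃ (W : Type) (T : SimpleGraph W), IsKTree k T ∧ ∃ φ : V → W, IsPartialHom G S T φ

theorem IsPartialKTree.treewidthAtMost {V : Type*} {G : SimpleGraph V} {S : Finset V} {k : ℕ}
    (h : IsPartialKTree G S k) : (G.induce (S : Set V)).TreewidthAtMost k := by
  obtain ⟨W, T, hT, φ, hφ⟩ := h
  exact ⟨W, T, hT, ⟨⟨⟨fun v => φ v, fun {a b} hab => hφ.adj a a.2 b b.2 hab⟩,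
    fun a b hab => Subtype.ext (hφ.injOn a.2 b.2 hab)⟩⟩⟩

theorem IsPartialKTree.mono {V : Type*} {G H : SimpleGraph V} {S T : Finset V} {k : ℕ}
    (h : IsPartialKTree H T k) (hST : S ⊆ T)
    (hGH : ∀ a ∈ S, ∀ b ∈ S, G.Adj a b → H.Adj a b) : IsPartialKTree G S k := by
  obtain ⟨W, T', hT', φ, hφ⟩ := h
  exact ⟨W, T', hT', φ, hφ.injOn.mono (by exact_mod_cast hST), fun a ha b hb hab =>
    hφ.adj a (hST ha) b (hST hb) (hGH a ha b hb hab)⟩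

section Attach

variable {W : Type} {T : SimpleGraph W} {x y z : W}

/-- Three pairwise adjacent vertices. -/
def IsTriangle (T : SimpleGraph W) (x y z : W) : Prop :=
  T.Adj x y ∧ T.Adj x z ∧ T.Adj y z

theorem IsKTree.attach_triangle (hT : IsKTree 3 T) (h : T.IsTriangle x y z) :
    IsKTree 3 (T.attachVertex {x, y, z}) := by
  classical
  have hc : T.IsNClique 3 {x, y, z} := is3Clique_triple_iff.2 ⟨h.1, h.2.1, h.2.2⟩
  have := IsKTree.attach T _ hT hc
  simpa using this

theorem IsTriangle.attach (h : T.IsTriangle x y z) :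
    (T.attachVertex {x, y, z}).IsTriangle none (some x) (some y) := by
  refine ⟨?_, ?_, h.1⟩
  · show x ∈ ({x, y, z} : Set W)
    simp
  · show y ∈ ({x, y, z} : Set W)
    simp

theorem IsKTree.exists_triangle (hT : IsKTree 3 T) : ∃ x y z, T.IsTriangle x y z := by
  induction hT with
  | complete => exact ⟨0, 1, 2, by simp [IsTriangle]⟩
  | attach T s hT hs ih =>
    obtain ⟨x, y, z, h⟩ := ih
    exact ⟨some x, some y, some z, h⟩

/-- Every edge of a `3`-tree lies in a triangle. -/
theorem IsKTree.exists_triangle_of_adj (hT : IsKTree 3 T) :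
    ∀ x y, T.Adj x y → ∃ z, T.IsTriangle x y z := by
  induction hT with
  | complete =>
    simp only [IsTriangle, top_adj]
    decide
  | attach T s hT hs ih =>
    have key : ∀ y ∈ s, ∃ z ∈ s, T.Adj y z := by
      intro y hy
      obtain ⟨z, hz, hzy⟩ := Finset.exists_mem_ne (by rw [hs.card_eq]; norm_num) y
      exact ⟨z, hz, hs.isClique hy hz hzy.symm⟩
    rintro (_ | x) (_ | y) hxy
    · exact absurd hxy (by simp)
    · obtain ⟨z, hz, hyz⟩ := key y hxy
      exact ⟨some z, hxy, hz, hyz⟩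
    · obtain ⟨z, hz, hyz⟩ := key x hxy
      exact ⟨some z, hxy, hyz, hz⟩
    · obtain ⟨z, hz⟩ := ih x y hxy
      exact ⟨some z, hz⟩

end Attach

variable {V : Type*} {G : SimpleGraph V} {S : Finset V}

theorem isPartialKTree_empty : IsPartialKTree G ∅ 3 :=
  ⟨Fin 3, ⊤, .complete, fun _ => 0, by simp, by simp⟩

theorem IsPartialHom.insert [DecidableEq V] {W : Type} {T : SimpleGraph W} {φ : V → W}
    (h : IsPartialHom G S T φ) {u : V} (hu : u ∉ S) {s : Set W}
    (hN : ∀ v ∈ S, G.Adj u v → φ v ∈ s) :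
    IsPartialHom G (insert u S) (T.attachVertex s)
      (Function.update (fun v => some (φ v)) u none) := by
  have hup : ∀ c ∈ S, Function.update (fun v => some (φ v)) u none c = some (φ c) := fun c hc =>
    Function.update_of_ne (fun he : c = u => hu (he ▸ hc)) _ _
  have huu : Function.update (fun v => some (φ v)) u none u = none := Function.update_self _ _ _
  constructor
  · intro x hx y hy hxy
    rw [Finset.mem_coe, Finset.mem_insert] at hx hy
    rcases hx with rfl | hx <;> rcases hy with rfl | hy
    · rfl
    · simp [hup y hy] at hxy
    · simp [hup x hx] at hxy
    · rw [hup x hx, hup y hy] at hxy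
      exact h.injOn hx hy (Option.some_injective _ hxy)
  · intro x hx y hy hxy
    rw [Finset.mem_insert] at hx hy
    rcases hx with rfl | hx <;> rcases hy with rfl | hy
    · exact absurd rfl hxy.ne
    · rw [huu, hup y hy]
      exact hN y hy hxy
    · rw [huu, hup x hx]
      exact hN x hx hxy.symm
    · rw [hup x hx, hup y hy]
      exact h.adj x hx y hy hxy

theorem IsPartialKTree.insert [DecidableEq V] (h : IsPartialKTree G S 3) {a b u : V} (ha : a ∈ S)
    (hb : b ∈ S) (hab : G.Adj a b) (hu : u ∉ S) (hN : ∀ v ∈ S, G.Adj u v → v = a ∨ v = b) :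
    IsPartialKTree G (insert u S) 3 := by
  obtain ⟨W, T, hT, φ, hφ⟩ := h
  obtain ⟨z, hz⟩ := hT.exists_triangle_of_adj _ _ (hφ.adj a ha b hb hab)
  refine ⟨_, _, hT.attach_triangle hz, _, hφ.insert hu fun v hv huv => ?_⟩
  rcases hN v hv huv with rfl | rfl <;> simp

/-- Starting from any triangle of the 3-tree, each new vertex is attached to the current triangle
and replaces one of its old corners. After three steps the triangle consists of new vertices, and
the fourth is attached to it. -/
theorem IsPartialKTree.union [DecidableEq V] {T : Finset V} (h : IsPartialKTree G S 3)
    (hT : T.card ≤ 4) (hST : Disjoint S T) (hN : ∀ a ∈ S, ∀ b ∈ T, ¬ G.Adj a b) :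
    IsPartialKTree G (S ∪ T) 3 := by
  have step : ∀ n : ℕ, n ≤ 3 → ∀ R : Finset V, R.card = n → R ⊆ T →
      ∃ (W : Type) (K : SimpleGraph W), IsKTree 3 K ∧ ∃ φ : V → W,
        IsPartialHom G (S ∪ R) K φ ∧
        ∃ x : Fin 3 → W, K.IsTriangle (x 0) (x 1) (x 2) ∧
          -- The new vertices occupy the first `n` corners, so the corner dropped in the next step
          -- is still an old one.
          ∀ v ∈ R, ∃ i : Fin 3, i.1 < n ∧ φ v = x i := by
    intro n
    induction n with
    | zero =>
      intro _ R hR _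
      obtain rfl := Finset.card_eq_zero.1 hR
      obtain ⟨W, K, hK, φ, hφ⟩ := h
      obtain ⟨x, y, z, hx⟩ := hK.exists_triangle
      exact ⟨W, K, hK, φ, by simpa using hφ, ![x, y, z], hx, by simp⟩
    | succ n ih =>
      intro hn R hR hRT
      obtain ⟨u, R, hu, rfl, hR'⟩ := Finset.card_eq_succ.1 hR
      have hRT' : R ⊆ T := (Finset.subset_insert _ _).trans hRT
      have huT : u ∈ T := hRT (Finset.mem_insert_self _ _)
      have huS : u ∉ S := fun h' => Finset.disjoint_left.1 hST h' huT
      obtain ⟨W, K, hK, φ, hφ, x, hx, hR⟩ := ih (by omega) R hR' hRT'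
      have huR : u ∉ S ∪ R := by simp [huS, hu]
      have hx' : ∀ i, x i ∈ ({x 0, x 1, x 2} : Set W) := by
        intro i; fin_cases i <;> simp
      refine ⟨_, _, hK.attach_triangle hx, Function.update (fun v => some (φ v)) u none, ?_,
        ![none, some (x 0), some (x 1)], hx.attach, ?_⟩
      · rw [Finset.union_insert]
        refine hφ.insert huR fun v hv huv => ?_
        rcases Finset.mem_union.1 hv with hv | hv
        · exact absurd huv.symm (hN v hv u huT)
        · obtain ⟨i, -, hi⟩ := hR v hv
          rw [hi]
          exact hx' i
      · intro v hv
        rcases Finset.mem_insert.1 hv with rfl | hv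
        · exact ⟨0, by simp, by simp⟩
        · obtain ⟨i, hi, hvi⟩ := hR v hv
          have hvu : v ≠ u := fun he => hu (he ▸ hv)
          rw [Function.update_of_ne hvu, hvi]
          fin_cases i
          · exact ⟨1, by simp at hi ⊢; omega, rfl⟩
          · exact ⟨2, by simp at hi ⊢; omega, rfl⟩
          · simp at hi; omega
  by_cases h3 : T.card ≤ 3
  · obtain ⟨W, K, hK, φ, hφ, -⟩ := step _ h3 T rfl subset_rfl
    exact ⟨W, K, hK, φ, hφ⟩
  · obtain ⟨u, R, hu, rfl, hR⟩ := Finset.card_eq_succ.1 (show T.card = 3 + 1 by omega)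
    have huT := Finset.mem_insert_self u R
    have huS : u ∉ S := fun h' => Finset.disjoint_left.1 hST h' huT
    obtain ⟨W, K, hK, φ, hφ, x, hx, hR⟩ := step 3 le_rfl R hR (Finset.subset_insert _ _)
    rw [Finset.union_insert]
    refine ⟨_, _, hK.attach_triangle hx, _, hφ.insert (by simp [huS, hu]) fun v hv huv => ?_⟩
    rcases Finset.mem_union.1 hv with hv | hv
    · exact absurd huv.symm (hN v hv u huT)
    · obtain ⟨i, -, hi⟩ := hR v hv
      rw [hi]
      fin_cases i <;> simp

end SimpleGraph

/-! ### Tame sets and the removal of vertices of degree at most two -/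

namespace SimpleGraph

variable {V : Type*} {G H : SimpleGraph V} {S T A B : Finset V} {a b u v : V} {k : ℕ}

/-- The subgraph of `G` induced by `S` has a straight-line drawing and is a partial `3`-tree. -/
def IsTame (G : SimpleGraph V) (S : Finset V) : Prop :=
  (∃ p, IsStraightDrawing G S p) ∧ IsPartialKTree G S 3

namespace IsTame

theorem empty : IsTame G ∅ :=
  ⟨⟨fun _ => 0, by simp, by simp, by simp⟩, isPartialKTree_empty⟩

theorem mono (h : IsTame H T) (hST : S ⊆ T) (hGH : ∀ a ∈ S, ∀ b ∈ S, G.Adj a b → H.Adj a b) :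
    IsTame G S :=
  ⟨h.1.imp fun _ hp => hp.mono hST hGH, h.2.mono hST hGH⟩

variable [DecidableEq V]

theorem insert (h : IsTame G S) (ha : a ∈ S) (hb : b ∈ S) (hab : G.Adj a b) (hu : u ∉ S)
    (hN : ∀ v ∈ S, G.Adj u v → v = a ∨ v = b) : IsTame G (insert u S) :=
  ⟨let ⟨_, hp⟩ := h.1; hp.exists_insert ha hb hab hu hN, h.2.insert ha hb hab hu hN⟩

theorem union (h : IsTame G S) (hT : T.card ≤ 4) (hST : Disjoint S T)
    (hN : ∀ a ∈ S, ∀ b ∈ T, ¬ G.Adj a b) : IsTame G (S ∪ T) :=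
  ⟨let ⟨_, hp⟩ := h.1; hp.exists_union hT hST hN, h.2.union hT hST hN⟩

/-- If `a` has a neighbour in `S`, the new vertex goes next to that edge. Otherwise `a` and `u` have
no edge to the rest, and these at most two vertices are placed apart. -/
theorem insert_pendant (h : IsTame G S) (hu : u ∉ S) (hN : ∀ v ∈ S, G.Adj u v → v = a) :
    IsTame G (Insert.insert u S) := by
  by_cases hb : a ∈ S ∧ ∃ b ∈ S, G.Adj a b
  · obtain ⟨ha, b, hb, hab⟩ := hb
    exact h.insert ha hb hab hu fun v hv huv => Or.inl (hN v hv huv)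
  · have h' : IsTame G (S.filter (· ≠ a)) :=
      h.mono (Finset.filter_subset _ _) fun _ _ _ _ hxy => hxy
    have hcard : (Insert.insert u (S.filter (· = a))).card ≤ 4 := by
      refine (Finset.card_insert_le _ _).trans ?_
      have : (S.filter (· = a)).card ≤ ({a} : Finset V).card :=
        Finset.card_le_card fun x hx => by simpa using (Finset.mem_filter.1 hx).2
      simp at this
      omega
    have := h'.union hcard (by
      rw [Finset.disjoint_left]
      intro x hx hx'
      rw [Finset.mem_filter] at hx
      rw [Finset.mem_insert, Finset.mem_filter] at hx'
      rcases hx' with rfl | hx'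
      · exact hu hx.1
      · exact hx.2 hx'.2) (by
      intro x hx y hy hxy
      rw [Finset.mem_filter] at hx
      rw [Finset.mem_insert, Finset.mem_filter] at hy
      rcases hy with rfl | ⟨hy, rfl⟩
      · exact hx.2 (hN x hx.1 hxy.symm)
      · exact hb ⟨hy, x, hx.1, hxy.symm⟩)
    refine this.mono (fun x hx => ?_) fun _ _ _ _ hxy => hxy
    simp only [Finset.mem_union, Finset.mem_insert, Finset.mem_filter] at hx ⊢
    tauto

/-- The added edge helps only if both ends survived the deletions; if one is missing, `u` is pendant
or isolated. -/
theorem insert_series (h : IsTame (G ⊔ edge a b) S) (hab : a ≠ b) (hu : u ∉ S)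
    (hN : ∀ v ∈ S, G.Adj u v → v = a ∨ v = b) : IsTame G (Insert.insert u S) := by
  have h' : IsTame G S := h.mono subset_rfl fun _ _ _ _ hxy => Or.inl hxy
  by_cases ha : a ∈ S
  · by_cases hb : b ∈ S
    · refine (h.insert ha hb (Or.inr (by simp [edge_adj, hab])) hu fun v hv huv => ?_).mono
        subset_rfl fun _ _ _ _ hxy => Or.inl hxy
      rcases huv with huv | huv
      · exact hN v hv huv
      · rw [edge_adj] at huv
        grind
    · exact h'.insert_pendant (a := a) hu fun v hv huv =>
        (hN v hv huv).resolve_right (by rintro rfl; exact hb hv)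
  · exact h'.insert_pendant (a := b) hu fun v hv huv =>
      (hN v hv huv).resolve_left (by rintro rfl; exact ha hv)

end IsTame

/-- Deleting at most `k` vertices from the subgraph of `G` induced by `A` makes it tame. -/
def IsTamable (G : SimpleGraph V) (A : Finset V) (k : ℕ) : Prop :=
  ∃ S ⊆ A, IsTame G S ∧ A.card ≤ S.card + k

open Classical in
/-- The number of neighbours of a vertex in a set. -/
noncomputable def degIn (G : SimpleGraph V) (A : Finset V) (v : V) : ℕ :=
  (A.filter (G.Adj v)).card

theorem degIn_eq_card (G : SimpleGraph V) (A : Finset V) (v : V) [DecidablePred (G.Adj v)] :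
    degIn G A v = (A.filter (G.Adj v)).card := by
  rw [degIn]
  congr

theorem degIn_mono (hAB : A ⊆ B) (v : V) : degIn G A v ≤ degIn G B v := by
  classical
  exact Finset.card_le_card (Finset.filter_subset_filter _ hAB)

variable [DecidableEq V]

theorem IsTamable.of_erase (hv : v ∈ A) (h : IsTamable G (A.erase v) k) :
    IsTamable G A (k + 1) := by
  obtain ⟨S, hS, hT, hc⟩ := h
  refine ⟨S, hS.trans (Finset.erase_subset _ _), hT, ?_⟩
  rw [Finset.card_erase_of_mem hv] at hc
  omega

theorem IsTamable.of_insert (hu : u ∈ A)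
    (h : ∀ S ⊆ A.erase u, u ∉ S → IsTame H S → IsTame G (insert u S))
    (hk : IsTamable H (A.erase u) k) : IsTamable G A k := by
  obtain ⟨S, hS, hT, hc⟩ := hk
  have huS : u ∉ S := fun h' => by simpa using hS h'
  refine ⟨insert u S, ?_, h S hS huS hT, ?_⟩
  · exact Finset.insert_subset hu (hS.trans (Finset.erase_subset _ _))
  · rw [Finset.card_erase_of_mem hu] at hc
    rw [Finset.card_insert_of_notMem huS]
    omega

theorem degIn_erase_of_adj (hv : v ∈ A) (huv : G.Adj u v) :
    degIn G (A.erase v) u + 1 = degIn G A u := by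
  classical
  have hmem : v ∈ A.filter (G.Adj u) := Finset.mem_filter.2 ⟨hv, huv⟩
  rw [degIn, degIn, Finset.filter_erase, Finset.card_erase_add_one hmem]

theorem degIn_erase_of_not_adj (huv : ¬ G.Adj u v) : degIn G (A.erase v) u = degIn G A u := by
  classical
  rw [degIn, degIn, Finset.filter_erase, Finset.erase_eq_of_notMem (by simp [huv])]

/-- Each of `a` and `b` loses the neighbour `u` and gains at most the other one. -/
theorem degIn_sup_edge_le (hu : u ∈ A) (hua : G.Adj u a) (hub : G.Adj u b) (v : V) :
    degIn (G ⊔ edge a b) (A.erase u) v ≤ degIn G A v := by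
  classical
  have main : ∀ c, G.Adj u v → (∀ x, (G ⊔ edge a b).Adj v x → G.Adj v x ∨ x = c) →
      degIn (G ⊔ edge a b) (A.erase u) v ≤ degIn G A v := by
    intro c huv hc
    rw [← degIn_erase_of_adj hu huv.symm, degIn_eq_card, degIn_eq_card]
    refine (Finset.card_le_card (t := insert c ((A.erase u).filter (G.Adj v))) ?_).trans
      (Finset.card_insert_le _ _)
    intro x hx
    rw [Finset.mem_filter] at hx
    rw [Finset.mem_insert, Finset.mem_filter]
    rcases hc x hx.2 with h | h
    · exact Or.inr ⟨hx.1, h⟩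
    · exact Or.inl h
  by_cases hva : v = a
  · subst hva
    refine main b hua fun x hx => ?_
    rw [sup_adj, edge_adj] at hx
    grind
  by_cases hvb : v = b
  · subst hvb
    refine main a hub fun x hx => ?_
    rw [sup_adj, edge_adj] at hx
    grind
  refine le_trans (le_of_eq ?_) (degIn_mono (Finset.erase_subset u A) v)
  rw [degIn_eq_card, degIn_eq_card]
  refine congrArg Finset.card (Finset.filter_congr fun x _ => ?_)
  rw [sup_adj, edge_adj]
  grind

/-- Vertices with at most two neighbours can be removed one after the other, joining the two
neighbours if there are two. -/
theorem exists_reduction (A : Finset V) : ∀ G : SimpleGraph V, ∃ (H : SimpleGraph V), ∃ B ⊆ A,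
    (∀ v ∈ B, 3 ≤ degIn H B v ∧ degIn H B v ≤ degIn G A v) ∧
    ∀ k, IsTamable H B k → IsTamable G A k := by
  classical
  induction A using Finset.strongInduction with
  | H A ih =>
  intro G
  by_cases h3 : ∀ v ∈ A, 3 ≤ degIn G A v
  · exact ⟨G, A, subset_rfl, fun v hv => ⟨h3 v hv, le_rfl⟩, fun _ h => h⟩
  push Not at h3
  obtain ⟨u, hu, hdeg⟩ := h3
  have hlt : A.erase u ⊂ A := Finset.erase_ssubset hu
  suffices ∃ G' : SimpleGraph V, (∀ v ∈ A.erase u, degIn G' (A.erase u) v ≤ degIn G A v) ∧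
      ∀ S ⊆ A.erase u, u ∉ S → IsTame G' S → IsTame G (insert u S) by
    obtain ⟨G', hd, hT⟩ := this
    obtain ⟨H, B, hB, hdB, hk⟩ := ih _ hlt G'
    exact ⟨H, B, hB.trans (Finset.erase_subset _ _),
      fun v hv => ⟨(hdB v hv).1, (hdB v hv).2.trans (hd v (hB hv))⟩,
      fun k h => (hk k h).of_insert hu hT⟩
  have hmem : ∀ S ⊆ A.erase u, ∀ v ∈ S, G.Adj u v → v ∈ A.filter (G.Adj u) := fun S hS v hv huv =>
    Finset.mem_filter.2 ⟨Finset.mem_of_mem_erase (hS hv), huv⟩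
  by_cases h1 : degIn G A u ≤ 1
  · refine ⟨G, fun v _ => degIn_mono (Finset.erase_subset _ _) v, fun S hS huS hT => ?_⟩
    obtain ⟨a, ha⟩ : ∃ a, ∀ v ∈ A.filter (G.Adj u), v = a := by
      rcases (A.filter (G.Adj u)).eq_empty_or_nonempty with h0 | ⟨a, ha⟩
      · exact ⟨u, by simp [h0]⟩
      · exact ⟨a, fun v hv => Finset.card_le_one.1 h1 v hv a ha⟩
    exact hT.insert_pendant (a := a) huS fun v hv huv => ha v (hmem S hS v hv huv)
  · have h2 : (A.filter (G.Adj u)).card = 2 := by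
      change degIn G A u = 2
      omega
    obtain ⟨a, b, hab, hN⟩ := Finset.card_eq_two.1 h2
    have ha : a ∈ A.filter (G.Adj u) := by simp [hN]
    have hb : b ∈ A.filter (G.Adj u) := by simp [hN]
    refine ⟨G ⊔ edge a b, fun v _ => degIn_sup_edge_le hu (Finset.mem_filter.1 ha).2
      (Finset.mem_filter.1 hb).2 v, fun S hS huS hT => ?_⟩
    refine hT.insert_series hab huS fun v hv huv => ?_
    have := hmem S hS v hv huv
    simpa [hN] using this

/-! ### The potential -/

/-- The contribution of a vertex of degree `d` to the number of deletions, in units of `1 / 240`. -/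
def degWeight : ℕ → ℕ
  | 0 | 1 | 2 => 0
  | 3 => 60
  | 4 => 90
  | d + 5 => 23 * (d + 5)

theorem degWeight_of_five_le {d : ℕ} (hd : 5 ≤ d) : degWeight d = 23 * d := by
  obtain ⟨d, rfl⟩ := Nat.exists_eq_add_of_le' hd
  rfl

/-- The increments from degree 2 on are 60, 30, 25 and then constantly 23. -/
theorem degWeight_succ {d : ℕ} (hd : 2 ≤ d) : degWeight d + 23 ≤ degWeight (d + 1) := by
  match d, hd with
  | 2, _ | 3, _ | 4, _ => decide
  | d + 5, _ => simp only [degWeight]; omega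

theorem degWeight_mono : Monotone degWeight := by
  refine monotone_nat_of_le_succ fun d => ?_
  match d with
  | 0 | 1 => decide
  | d + 2 => exact (Nat.le_add_right _ _).trans (degWeight_succ (by omega))

theorem degWeight_le (d : ℕ) : degWeight d ≤ 23 * d := by
  match d with
  | 0 | 1 | 2 | 3 | 4 => decide
  | d + 5 => rfl

/-- The total weight of the vertices of an induced subgraph. -/
noncomputable def weight (G : SimpleGraph V) (A : Finset V) : ℕ :=
  ∑ v ∈ A, degWeight (degIn G A v)

-- A deletion releases the weight of `v` itself and, for each neighbour, the drop caused by losing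
-- one degree; `c` is a lower bound for these drops.
open Classical in
theorem weight_erase_add_le (hv : v ∈ A) (c : V → ℕ)
    (hc : ∀ w ∈ A, G.Adj v w → degWeight (degIn G A w - 1) + c w ≤ degWeight (degIn G A w)) :
    weight G (A.erase v) + degWeight (degIn G A v) + ∑ w ∈ A.filter (G.Adj v), c w ≤
      weight G A := by
  have h1 : ∑ w ∈ A.filter (G.Adj v), c w = ∑ w ∈ A.erase v, if G.Adj v w then c w else 0 := by
    rw [← Finset.sum_filter, Finset.filter_erase, Finset.erase_eq_of_notMem (by simp)]
  have h2 : weight G (A.erase v) + ∑ w ∈ A.filter (G.Adj v), c w ≤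
      ∑ w ∈ A.erase v, degWeight (degIn G A w) := by
    rw [h1, weight, ← Finset.sum_add_distrib]
    refine Finset.sum_le_sum fun w hw => ?_
    by_cases hvw : G.Adj v w
    · rw [if_pos hvw]
      have := hc w (Finset.mem_of_mem_erase hw) hvw
      rwa [← degIn_erase_of_adj hv hvw.symm, Nat.add_sub_cancel,
        degIn_erase_of_adj hv hvw.symm] at this
    · rw [if_neg hvw, add_zero, degIn_erase_of_not_adj fun h => hvw h.symm]
  rw [weight.eq_def G A, ← Finset.sum_erase_add A _ hv]
  omega

theorem weight_erase_add_mul_le (hv : v ∈ A) (c : ℕ)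
    (hc : ∀ w ∈ A, G.Adj v w → degWeight (degIn G A w - 1) + c ≤ degWeight (degIn G A w)) :
    weight G (A.erase v) + degWeight (degIn G A v) + degIn G A v * c ≤ weight G A := by
  have := weight_erase_add_le hv (fun _ => c) hc
  rwa [Finset.sum_const, smul_eq_mul] at this

/-- Surviving vertices do not gain weight, and each vanished vertex of `X` gives up at least the
weight 60 of degree 3. -/
theorem weight_add_le {X : Finset V} (hBA : B ⊆ A) (hXA : X ⊆ A) (hBX : Disjoint B X)
    (hB : ∀ v ∈ B, degIn H B v ≤ degIn G A v) (hX : ∀ v ∈ X, 3 ≤ degIn G A v) :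
    weight H B + X.card * 60 ≤ weight G A := by
  have h1 : weight H B ≤ ∑ v ∈ B, degWeight (degIn G A v) :=
    Finset.sum_le_sum fun v hv => degWeight_mono (hB v hv)
  have h2 : X.card * 60 ≤ ∑ v ∈ X, degWeight (degIn G A v) := by
    rw [← smul_eq_mul]
    exact Finset.card_nsmul_le_sum _ _ _ fun v hv => degWeight_mono (hX v hv)
  have h3 : ∑ v ∈ B ∪ X, degWeight (degIn G A v) ≤ weight G A :=
    Finset.sum_le_sum_of_subset (Finset.union_subset hBA hXA)
  rw [Finset.sum_union hBX] at h3
  omega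

/-! ### The induction on graphs of minimum degree three -/

/-- The bound for graphs of minimum degree at least three, with some slack for graphs of maximum
degree at most four that are not regular of degree four. -/
def HasBound (G : SimpleGraph V) (A : Finset V) : Prop :=
  ∃ k, IsTamable G A k ∧ 240 * k ≤ weight G A ∧
    ((∀ v ∈ A, degIn G A v ≤ 4) → (∃ v ∈ A, degIn G A v = 3) → 240 * k + 30 ≤ weight G A)

theorem exists_isTamable_of_erase
    (ih : ∀ B ⊂ A, ∀ H : SimpleGraph V, (∀ v ∈ B, 3 ≤ degIn H B v) → HasBound H B) (hv : v ∈ A)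
    (hw : weight G (A.erase v) + 240 ≤ weight G A) :
    ∃ k, IsTamable G A k ∧ 240 * k ≤ weight G A := by
  obtain ⟨H, B, hB, hd, hk⟩ := exists_reduction (A.erase v) G
  obtain ⟨k, hkB, hk1, -⟩ := ih B (hB.trans_ssubset (Finset.erase_ssubset hv)) H
    fun w hw => (hd w hw).1
  refine ⟨k + 1, (hk k hkB).of_erase hv, ?_⟩
  have := weight_add_le hB (Finset.empty_subset _) (Finset.disjoint_empty_right _)
    (fun w hw => (hd w hw).2) (by simp)
  simp only [Finset.card_empty] at this
  omega

/-- The set `X` is a witness that the slack survives: either the reduced graph has a vertex of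
degree 3 and hands on its own slack, or `v` and all of `X` have disappeared. -/
theorem exists_isTamable_slack_of_erase
    (ih : ∀ B ⊂ A, ∀ H : SimpleGraph V, (∀ v ∈ B, 3 ≤ degIn H B v) → HasBound H B) (hv : v ∈ A)
    (hw : weight G (A.erase v) + 240 ≤ weight G A) (h3 : ∀ w ∈ A, 3 ≤ degIn G A w)
    (h4 : ∀ w ∈ A, degIn G A w ≤ 4) {X : Finset V} (hX : X ⊆ A.erase v) (hXc : 4 ≤ X.card)
    (hX3 : ∀ w ∈ X, degIn G (A.erase v) w ≤ 3) :
    ∃ k, IsTamable G A k ∧ 240 * k + 30 ≤ weight G A := by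
  obtain ⟨H, B, hB, hd, hk⟩ := exists_reduction (A.erase v) G
  obtain ⟨k, hkB, hk1, hk2⟩ := ih B (hB.trans_ssubset (Finset.erase_ssubset hv)) H
    fun w hw => (hd w hw).1
  have hBA := hB.trans (Finset.erase_subset v A)
  have hdA : ∀ w ∈ B, degIn H B w ≤ degIn G A w := fun w hw =>
    (hd w hw).2.trans (degIn_mono (Finset.erase_subset _ _) w)
  refine ⟨k + 1, (hk k hkB).of_erase hv, ?_⟩
  by_cases hB3 : ∃ w ∈ B, degIn H B w = 3
  · have h5 := hk2 (fun w hw => (hdA w hw).trans (h4 w (hBA hw))) hB3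
    have := weight_add_le hB (Finset.empty_subset _) (Finset.disjoint_empty_right _)
      (fun w hw => (hd w hw).2) (by simp)
    simp only [Finset.card_empty] at this
    omega
  -- A surviving member of `X` would have degree exactly 3. So five vertices vanish, and 5·60 = 300
  -- pays for the deletion with 60 to spare.
  · have hvX : v ∉ X := fun h => by simpa using hX h
    have hXA : insert v X ⊆ A := Finset.insert_subset hv (hX.trans (Finset.erase_subset _ _))
    have hdis : Disjoint B (insert v X) := by
      rw [Finset.disjoint_left]
      intro w hw hw'
      rcases Finset.mem_insert.1 hw' with h | hw'
      · exact Finset.ne_of_mem_erase (hB hw) h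
      · exact hB3 ⟨w, hw, le_antisymm ((hd w hw).2.trans (hX3 w hw')) (hd w hw).1⟩
    have := weight_add_le hBA hXA hdis hdA fun w hw => h3 w (hXA hw)
    rw [Finset.card_insert_of_notMem hvX] at this
    omega

theorem hasBound_of_regular_four
    (ih : ∀ B ⊂ A, ∀ H : SimpleGraph V, (∀ v ∈ B, 3 ≤ degIn H B v) → HasBound H B)
    (h4 : ∀ w ∈ A, degIn G A w = 4) : HasBound G A := by
  classical
  suffices ∃ k, IsTamable G A k ∧ 240 * k ≤ weight G A by
    obtain ⟨k, h1, h2⟩ := this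
    exact ⟨k, h1, h2, fun _ ⟨v, hv, hv3⟩ => by have := h4 v hv; omega⟩
  rcases A.eq_empty_or_nonempty with rfl | ⟨v, hv⟩
  · exact ⟨0, ⟨∅, subset_rfl, IsTame.empty, by simp⟩, by simp⟩
  have hw := weight_erase_add_mul_le (G := G) hv 30 fun w hw _ => by rw [h4 w hw]; decide
  rw [h4 v hv, show degWeight 4 = 90 from rfl] at hw
  have hd : ∀ w ∈ A.erase v, 3 ≤ degIn G (A.erase v) w ∧ degIn G (A.erase v) w ≤ 4 := by
    intro w hw
    have hw4 := h4 w (Finset.mem_of_mem_erase hw)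
    by_cases hvw : G.Adj w v
    · have := degIn_erase_of_adj hv hvw
      omega
    · have := degIn_erase_of_not_adj (A := A) hvw
      omega
  obtain ⟨u, hu⟩ : (A.filter (G.Adj v)).Nonempty := by
    rw [← Finset.card_pos]
    change 0 < degIn G A v
    rw [h4 v hv]
    decide
  rw [Finset.mem_filter] at hu
  -- No reduction is needed here: degrees stay 3 or 4, and the neighbour `u` now has degree 3. The
  -- slack 30 completes the released 210.
  obtain ⟨k, hk, -, hk2⟩ := ih _ (Finset.erase_ssubset hv) G fun w hw => (hd w hw).1
  have := hk2 (fun w hw => (hd w hw).2) ⟨u, Finset.mem_erase.2 ⟨hu.2.ne', hu.1⟩, by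
    have := degIn_erase_of_adj hv hu.2.symm
    have := h4 u hu.1
    omega⟩
  exact ⟨k + 1, hk.of_erase hv, by omega⟩

/-- Vertices of degree 3 are adjacent only to each other. With five or more of them, deleting one
releases 60 + 3·60 = 240 and leaves four as witnesses of slack; otherwise there are exactly four,
and no deletion among them is needed. -/
theorem exists_isTamable_of_cubic
    (ih : ∀ B ⊂ A, ∀ H : SimpleGraph V, (∀ v ∈ B, 3 ≤ degIn H B v) → HasBound H B)
    (h3 : ∀ w ∈ A, 3 ≤ degIn G A w) (h4 : ∀ w ∈ A, degIn G A w ≤ 4) (hv : v ∈ A)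
    (hv3 : degIn G A v = 3)
    (hN : ∀ x ∈ A, ∀ y ∈ A, degIn G A x = 3 → G.Adj x y → degIn G A y = 3) :
    ∃ k, IsTamable G A k ∧ 240 * k + 30 ≤ weight G A := by
  classical
  set X := A.filter fun w => degIn G A w = 3 with hX
  have hvX : v ∈ X := Finset.mem_filter.2 ⟨hv, hv3⟩
  by_cases hXc : 5 ≤ X.card
  · have hw := weight_erase_add_mul_le (G := G) hv 60 fun w hw hvw => by
      rw [hN v hv w hw hv3 hvw]; decide
    rw [hv3, show degWeight 3 = 60 from rfl] at hw
    refine exists_isTamable_slack_of_erase ih hv (by omega) h3 h4 (X := X.erase v)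
      (Finset.erase_subset_erase _ (Finset.filter_subset _ _)) ?_ ?_
    · rw [Finset.card_erase_of_mem hvX]
      omega
    · intro w hw
      rw [← (Finset.mem_filter.1 (Finset.mem_of_mem_erase hw)).2]
      exact degIn_mono (Finset.erase_subset _ _) w
  have hXA : X ⊆ A := Finset.filter_subset _ _
  have hXc : X.card = 4 := by
    have hsub : insert v (A.filter (G.Adj v)) ⊆ X := by
      refine Finset.insert_subset hvX fun w hw => ?_
      rw [Finset.mem_filter] at hw
      exact Finset.mem_filter.2 ⟨hw.1, hN v hv w hw.1 hv3 hw.2⟩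
    have := Finset.card_le_card hsub
    rw [Finset.card_insert_of_notMem (by simp), show (A.filter (G.Adj v)).card = 3 from hv3] at this
    omega
  have hsep : ∀ x ∈ A \ X, ∀ y ∈ X, ¬ G.Adj x y := by
    intro x hx y hy hxy
    rw [Finset.mem_sdiff] at hx
    rw [Finset.mem_filter] at hy
    exact hx.2 (Finset.mem_filter.2 ⟨hx.1, hN y hy.1 x hx.1 hy.2 hxy.symm⟩)
  have hd : ∀ x ∈ A \ X, degIn G (A \ X) x = degIn G A x := by
    intro x hx
    refine congrArg Finset.card ?_
    ext y
    simp only [Finset.mem_filter, Finset.mem_sdiff]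
    exact ⟨fun h => ⟨h.1.1, h.2⟩, fun h => ⟨⟨h.1, fun hy => hsep x hx y hy h.2⟩, h.2⟩⟩
  obtain ⟨k, ⟨S, hS, hT, hc⟩, hk, -⟩ := ih (A \ X) (Finset.sdiff_ssubset hXA ⟨v, hvX⟩) G
    fun x hx => (hd x hx).symm ▸ h3 x (Finset.mem_sdiff.1 hx).1
  have hSX : Disjoint S X := Finset.sdiff_disjoint.mono_left hS
  refine ⟨k, ⟨S ∪ X, Finset.union_subset (hS.trans Finset.sdiff_subset) hXA,
    hT.union hXc.le hSX fun a ha => hsep a (hS ha), ?_⟩, ?_⟩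
  · rw [Finset.card_union_of_disjoint hSX]
    rw [Finset.card_sdiff_of_subset hXA] at hc
    omega
  -- The four kept vertices contribute 240 units that nothing has to be paid from.
  · have := weight_add_le Finset.sdiff_subset hXA Finset.sdiff_disjoint
      (fun x hx => (hd x hx).le) fun x hx => h3 x (hXA hx)
    omega

theorem hasBound (A : Finset V) :
    ∀ G : SimpleGraph V, (∀ v ∈ A, 3 ≤ degIn G A v) → HasBound G A := by
  classical
  induction A using Finset.strongInduction with
  | H A ih =>
  intro G h3
  by_cases h6 : ∃ v ∈ A, 6 ≤ degIn G A v
  · obtain ⟨v, hv, hv6⟩ := h6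
    have hw := weight_erase_add_mul_le (G := G) hv 23 fun w hw _ => by
      have := h3 w hw
      have := degWeight_succ (d := degIn G A w - 1) (by omega)
      rwa [Nat.sub_add_cancel (by omega)] at this
    rw [degWeight_of_five_le (by omega)] at hw
    obtain ⟨k, hk, hk'⟩ := exists_isTamable_of_erase ih hv (G := G) (by omega)
    exact ⟨k, hk, hk', fun h => absurd (h v hv) (by omega)⟩
  push Not at h6
  by_cases h5 : ∃ v ∈ A, 5 ≤ degIn G A v
  · obtain ⟨v, hv, hv5⟩ := h5
    -- With maximum degree 5 the smallest drop is 115 - 90 = 25, and 115 + 5·25 is exactly 240.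
    have hw := weight_erase_add_mul_le (G := G) hv 25 fun w hw _ => by
      have := h3 w hw
      have := h6 w hw
      generalize degIn G A w = d at *
      interval_cases d <;> decide
    rw [degWeight_of_five_le hv5] at hw
    obtain ⟨k, hk, hk'⟩ := exists_isTamable_of_erase ih hv (G := G) (by omega)
    exact ⟨k, hk, hk', fun h => absurd (h v hv) (by omega)⟩
  push Not at h5
  have h4 : ∀ v ∈ A, degIn G A v ≤ 4 := fun v hv => Nat.le_of_lt_succ (h5 v hv)
  by_cases hreg : ∀ v ∈ A, degIn G A v = 4
  · exact hasBound_of_regular_four ih hreg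
  suffices ∃ k, IsTamable G A k ∧ 240 * k + 30 ≤ weight G A by
    obtain ⟨k, hk, hk'⟩ := this
    exact ⟨k, hk, by omega, fun _ _ => hk'⟩
  have h34 : ∀ v ∈ A, degIn G A v = 3 ∨ degIn G A v = 4 := fun v hv => by
    have := h3 v hv
    have := h4 v hv
    omega
  by_cases hmix : ∃ x ∈ A, ∃ y ∈ A, degIn G A x = 3 ∧ G.Adj x y ∧ degIn G A y = 4
  · obtain ⟨u, hu, v, hv, hu3, huv, hv4⟩ := hmix
    have hmem : u ∈ A.filter (G.Adj v) := Finset.mem_filter.2 ⟨hu, huv.symm⟩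
    have hw := weight_erase_add_le (G := G) hv (fun w => if w = u then 60 else 30) fun w hw _ => by
      by_cases hwu : w = u
      · rw [if_pos hwu, hwu, hu3]
        decide
      · rw [if_neg hwu]
        rcases h34 w hw with h | h <;> rw [h] <;> decide
    -- One neighbour falls from 3 to 2 and releases 60, the other three at least 30 each; with the
    -- 90 of `v` this makes 240.
    have hsum : ∑ w ∈ A.filter (G.Adj v), (if w = u then 60 else 30) = 150 := by
      rw [← Finset.add_sum_erase _ _ hmem, if_pos rfl,
        Finset.sum_congr rfl fun w hw => if_neg (Finset.ne_of_mem_erase hw), Finset.sum_const,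
        Finset.card_erase_of_mem hmem, show (A.filter (G.Adj v)).card = 4 from hv4]
      rfl
    rw [hsum, hv4, show degWeight 4 = 90 from rfl] at hw
    refine exists_isTamable_slack_of_erase ih hv (by omega) h3 h4 (X := A.filter (G.Adj v))
      (fun w hw => ?_) hv4.ge fun w hw => ?_
    · rw [Finset.mem_filter] at hw
      exact Finset.mem_erase.2 ⟨hw.2.ne', hw.1⟩
    · rw [Finset.mem_filter] at hw
      have := degIn_erase_of_adj hv hw.2.symm
      have := h4 w hw.1
      omega
  · push Not at hreg hmix
    obtain ⟨v, hv, hv4⟩ := hreg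
    exact exists_isTamable_of_cubic ih h3 h4 hv ((h34 v hv).resolve_right hv4)
      fun x hx y hy hx3 hxy => (h34 y hy).resolve_right (hmix x hx y hy hx3 hxy)

theorem exists_isTamable_univ [Fintype V] (G : SimpleGraph V) [Fintype G.edgeSet] :
    ∃ k, IsTamable G Finset.univ k ∧ 120 * k ≤ 23 * G.edgeFinset.card := by
  classical
  obtain ⟨H, B, hB, hd, hk⟩ := exists_reduction Finset.univ G
  obtain ⟨k, hkB, hkw, -⟩ := hasBound B H fun v hv => (hd v hv).1
  refine ⟨k, hk k hkB, ?_⟩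
  have h1 : weight H B ≤ ∑ v ∈ B, 23 * degIn G Finset.univ v :=
    Finset.sum_le_sum fun v hv => (degWeight_le _).trans (Nat.mul_le_mul_left _ (hd v hv).2)
  have h2 : ∑ v ∈ B, 23 * degIn G Finset.univ v ≤ ∑ v, 23 * degIn G Finset.univ v :=
    Finset.sum_le_sum_of_subset hB
  have h3 : ∑ v, 23 * degIn G Finset.univ v = 23 * (2 * G.edgeFinset.card) := by
    have hdeg : ∑ v, degIn G Finset.univ v = ∑ v, G.degree v :=
      Finset.sum_congr rfl fun v _ => by
        rw [degIn_eq_card, ← card_neighborFinset_eq_degree, neighborFinset_eq_filter]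
    rw [← Finset.mul_sum, hdeg, sum_degrees_eq_twice_card_edges]
    convert rfl
  -- Here 240 k ≤ 46 m by the handshake lemma, which is twice the claim.
  omega

end SimpleGraph

theorem theorem3 {V : Type*} [Fintype V] (G : SimpleGraph V) [Fintype G.edgeSet] :
    ∃ S : Finset V,
      (G.induce (S : Set V)).IsPlanar ∧
      (G.induce (S : Set V)).TreewidthAtMost 3 ∧
      (Fintype.card V : ℝ) - 23 * (G.edgeFinset.card : ℝ) / 120 ≤ (S.card : ℝ) := by
  classical
  obtain ⟨k, ⟨S, -, ⟨⟨p, hp⟩, hT⟩, hc⟩, hk⟩ := G.exists_isTamable_univ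
  refine ⟨S, hp.isPlanar, hT.treewidthAtMost, ?_⟩
  have hc' : (Fintype.card V : ℝ) ≤ S.card + k := by exact_mod_cast hc
  have hk' : 120 * (k : ℝ) ≤ 23 * G.edgeFinset.card := by exact_mod_cast hk
  linarith
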